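/- **Proposition 4.20.** All vector spaces are finite-dimensional over $\mathbb{F}_2$. A quadratic form on $V$ is a map $q:V\to\mathbb{F}_2$ such that $B(x,y)=q(x+y)+q(x)+q(y)$ is bilinear; $(V,q)$ is non-degenerate if $\{v : B(v,w)=0\ \forall w\in V\}=0$. Let $\mathcal{E}_q^{\mathrm{deg}}$ be the category of (possibly degenerate) quadratic spaces and injective linear maps preserving the quadratic forms (it has pullbacks), and let $\mathcal{E}_q$ be the category of non-degenerate quadratic spaces and linear maps preserving the quadratic forms (these are automatically injective). Let $\mathcal{T}_q$ be the category with the objects of $\mathcal{E}_q$, in which a morphism $V\to W$ is a class $[V\to X\leftarrow W]$ of diagrams in $\mathcal{E}_q$ for the equivalence relation generated by identifying $V\to X_1\leftarrow W$ with $V\to X_2\leftarrow W$ whenever there is a morphism $\alpha:X_1\to X_2$ of $\mathcal{E}_q$ compatible with the maps from $V$ and $W$. The composite of $[V\to X_1\leftarrow W]$ and $[W\to X_2\leftarrow Y]$ is $[V\to X_1\perp_W X_2\leftarrow Y]$, where $X_1\perp_W X_2=W\perp W'\perp W''$ is the pseudo push-out, $W'$ and $W''$ being the orthogonal complements of the images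 of $W$ in $X_1\simeq W\perp W'$ and $X_2\simeq W\perp W''$. Let $\mathrm{Sp}(\mathcal{E}_q^{\mathrm{deg}})$ be the category with the objects of $\mathcal{E}_q^{\mathrm{deg}}$, whose morphisms $V\to W$ are the classes $[V\leftarrow D\to W]$ of spans in $\mathcal{E}_q^{\mathrm{deg}}$ up to isomorphism of $D$ compatible with the maps to $V$ and $W$, composed by pullback, and let $\mathcal{S}_q$ be its full subcategory on the non-degenerate quadratic spaces. Let $\sigma:\mathcal{T}_q\to\mathcal{S}_q$ be the functor with $\sigma(V)=V$ and $$\sigma([V\to X\leftarrow W])=[V\leftarrow V\times_X W\to W],$$ where $V\times_X W$ is the pullback in $\mathcal{E}_q^{\mathrm{deg}}$. Then $\sigma$ is full. Explicitly: for all non-degenerate $V,W$, every possibly degenerate quadratic space $D$ and all morphisms $V\xleftarrow{f}D\xrightarrow{g}W$ of $\mathcal{E}_q^{\mathrm{deg}}$, there are a non-degenerate quadratic space $X$ and morphisms $V\xrightarrow{a}X\xleftarrow{b}W$ of $\mathcal{E}_q$ with $\sigma([V\xrightarrow{a}X\xleftarrow{b}W])=[V\xleftarrow{f}D\xrightarrow{g}W]$.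 -/

import Mathlib

open CategoryTheory CategoryTheory.Limits

universe u

noncomputable section

namespace QuadF2

/-! ### Quadratic spaces over `𝔽₂` -/

/-- A finite-dimensional `𝔽₂`-vector space with a (possibly degenerate) quadratic form.
These are the objects of the category `E_q^deg`. -/
structure QSpace : Type (u + 1) where
  /-- the underlying vector space -/
  carrier : Type u
  [addCommGroup : AddCommGroup carrier]
  [module : Module (ZMod 2) carrier]
  [finite : FiniteDimensional (ZMod 2) carrier]
  /-- the quadratic form -/
  form : QuadraticForm (ZMod 2) carrier

attribute [instance] QSpace.addCommGroup QSpace.module QSpace.finite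

/-- The bilinear form `B(x, y) = q(x + y) - q(x) - q(y)` of a quadratic space. -/
abbrev QSpace.B (V : QSpace.{u}) : LinearMap.BilinForm (ZMod 2) V.carrier :=
  V.form.polarBilin

/-- The radical `{v | ∀ w, B(v, w) = 0}` of the associated bilinear form. (In characteristic two
this is in general larger than `QuadraticMap.radical`.) -/
def QSpace.rad (V : QSpace.{u}) : Submodule (ZMod 2) V.carrier where
  carrier := {v | ∀ w, V.B v w = 0}
  zero_mem' w := by simp
  add_mem' {a b} ha hb w := by rw [map_add, LinearMap.add_apply, ha w, hb w, add_zero]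
  smul_mem' c a ha w := by rw [map_smul, LinearMap.smul_apply, ha w, smul_zero]

/-- A quadratic space is non-degenerate if its radical is zero. -/
def QSpace.IsNondegenerate (V : QSpace.{u}) : Prop := V.rad = ⊥

theorem QSpace.B_comm (V : QSpace.{u}) (x y : V.carrier) : V.B x y = V.B y x := by
  simp only [QuadraticMap.polarBilin_apply_apply]
  exact QuadraticMap.polar_comm _ _ _

theorem QSpace.form_add (V : QSpace.{u}) (x y : V.carrier) :
    V.form (x + y) = V.form x + V.form y + V.B x y :=
  QuadraticMap.map_add V.form x y

theorem QSpace.isNondegenerate_iff (V : QSpace.{u}) :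
    V.IsNondegenerate ↔ ∀ v, (∀ w, V.B v w = 0) → v = 0 := by
  unfold QSpace.IsNondegenerate
  rw [Submodule.eq_bot_iff]
  exact Iff.rfl

/-! ### The category `E_q^deg` -/

/-- Morphisms of `E_q^deg`: injective linear maps preserving the quadratic forms. -/
@[ext]
structure QSpace.Hom (V W : QSpace.{u}) : Type u where
  /-- the underlying linear map preserving the quadratic forms -/
  toIsometry : V.form →qᵢ W.form
  injective : Function.Injective toIsometry

instance : Category QSpace.{u} where
  Hom V W := QSpace.Hom V W
  id V := ⟨QuadraticMap.Isometry.id V.form, fun _ _ h => h⟩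
  comp f g := ⟨g.toIsometry.comp f.toIsometry, fun _ _ h => f.injective (g.injective h)⟩

@[simp]
theorem QSpace.id_apply (V : QSpace.{u}) (x : V.carrier) :
    QSpace.Hom.toIsometry (𝟙 V) x = x := rfl

@[simp]
theorem QSpace.comp_apply {U V W : QSpace.{u}} (f : U ⟶ V) (g : V ⟶ W) (x : U.carrier) :
    QSpace.Hom.toIsometry (f ≫ g) x = g.toIsometry (f.toIsometry x) := rfl

theorem QSpace.hom_ext {V W : QSpace.{u}} {f g : V ⟶ W}
    (h : ∀ x, f.toIsometry x = g.toIsometry x) : f = g :=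
  QSpace.Hom.ext (DFunLike.ext _ _ h)

theorem QSpace.hom_congr {V W : QSpace.{u}} {f g : V ⟶ W} (h : f = g) (x : V.carrier) :
    f.toIsometry x = g.toIsometry x := by rw [h]

instance {V W : QSpace.{u}} (f : V ⟶ W) : Mono f :=
  ⟨fun _ _ h => QSpace.hom_ext fun x => f.injective (QSpace.hom_congr h x)⟩

theorem QSpace.isPullback_of_elements {P V W X : QSpace.{u}} {p : P ⟶ V} {r : P ⟶ W}
    {f : V ⟶ X} {g : W ⟶ X} (w : p ≫ f = r ≫ g)
    (h : ∀ v w, f.toIsometry v = g.toIsometry w →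
      ∃ z, p.toIsometry z = v ∧ r.toIsometry z = w) : IsPullback p r f g := by
  have key : ∀ s : PullbackCone f g, ∃ l : s.pt ⟶ P, l ≫ p = s.fst ∧ l ≫ r = s.snd := by
    intro s
    have hs : ∀ x, ∃ z, p.toIsometry z = s.fst.toIsometry x ∧ r.toIsometry z = s.snd.toIsometry x :=
      fun x => h _ _ (QSpace.hom_congr s.condition x)
    choose φ h1 h2 using hs
    exact
      ⟨{ toIsometry :=
          { toFun := φ
            map_add' := fun x y => p.injective (by rw [map_add, h1, h1, h1, map_add])
            map_smul' := fun c x => p.injective (by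
              rw [RingHom.id_apply, map_smul, h1, h1, map_smul])
            map_app' := fun x => by
              change P.form (φ x) = _
              rw [← p.toIsometry.map_app, h1, s.fst.toIsometry.map_app] }
         injective := fun x y hxy => s.fst.injective (by
          have hxy' : φ x = φ y := hxy
          rw [← h1, ← h1, hxy']) }, QSpace.hom_ext h1, QSpace.hom_ext h2⟩
  choose l h1 h2 using key
  exact ⟨⟨w⟩, ⟨PullbackCone.IsLimit.mk w l h1 h2 fun s m hm _ => by
    rw [← cancel_mono p, hm, h1]⟩⟩

/-- The fibre product of quadratic spaces, `{(v, w) | f v = g w}` with the form induced from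
`V` (equivalently from `W`). -/
def QSpace.fiberProduct {V W X : QSpace.{u}} (f : V ⟶ X) (g : W ⟶ X) : QSpace.{u} where
  carrier := LinearMap.eqLocus (f.toIsometry.toLinearMap ∘ₗ LinearMap.fst (ZMod 2) V.carrier W.carrier)
    (g.toIsometry.toLinearMap ∘ₗ LinearMap.snd (ZMod 2) V.carrier W.carrier)
  form := V.form.comp (LinearMap.fst (ZMod 2) V.carrier W.carrier ∘ₗ Submodule.subtype _)

/-- The first projection of the fibre product. -/
def QSpace.fiberProductFst {V W X : QSpace.{u}} (f : V ⟶ X) (g : W ⟶ X) :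
    QSpace.fiberProduct f g ⟶ V where
  toIsometry :=
    { toLinearMap := LinearMap.fst (ZMod 2) V.carrier W.carrier ∘ₗ Submodule.subtype _
      map_app' := fun _ => rfl }
  injective := by
    rintro ⟨⟨v, w⟩, h⟩ ⟨⟨v', w'⟩, h'⟩ (e : v = v')
    subst e
    have h1 : f.toIsometry v = g.toIsometry w := h
    have h2 : f.toIsometry v = g.toIsometry w' := h'
    have : w = w' := g.injective (h1.symm.trans h2)
    subst this
    rfl

/-- The second projection of the fibre product. -/
def QSpace.fiberProductSnd {V W X : QSpace.{u}} (f : V ⟶ X) (g : W ⟶ X) :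
    QSpace.fiberProduct f g ⟶ W where
  toIsometry :=
    { toLinearMap := LinearMap.snd (ZMod 2) V.carrier W.carrier ∘ₗ Submodule.subtype _
      map_app' := by
        rintro ⟨⟨v, w⟩, h⟩
        have h1 : f.toIsometry v = g.toIsometry w := h
        change W.form w = V.form v
        rw [← f.toIsometry.map_app, ← g.toIsometry.map_app, h1] }
  injective := by
    rintro ⟨⟨v, w⟩, h⟩ ⟨⟨v', w'⟩, h'⟩ (e : w = w')
    subst e
    have h1 : f.toIsometry v = g.toIsometry w := h
    have h2 : f.toIsometry v' = g.toIsometry w := h'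
    have : v = v' := f.injective (h1.trans h2.symm)
    subst this
    rfl

theorem QSpace.isPullback_fiberProduct {V W X : QSpace.{u}} (f : V ⟶ X) (g : W ⟶ X) :
    IsPullback (QSpace.fiberProductFst f g) (QSpace.fiberProductSnd f g) f g :=
  QSpace.isPullback_of_elements (QSpace.hom_ext fun z => z.2)
    fun v w h => ⟨⟨(v, w), h⟩, rfl, rfl⟩

/-- `E_q^deg` has pullbacks. -/
instance : HasPullbacks QSpace.{u} :=
  haveI : ∀ {V W X : QSpace.{u}} {f : V ⟶ X} {g : W ⟶ X}, HasLimit (cospan f g) :=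
    fun {_ _ _ f g} => (QSpace.isPullback_fiberProduct f g).hasPullback
  hasPullbacks_of_hasLimit_cospan _

/-! ### The category of spans -/

/-- The category `Sp(C)` of spans in a category with pullbacks: same objects as `C`. -/
structure Sp (C : Type*) where
  /-- the underlying object -/
  obj : C

section Sp

variable {C : Type*} [Category* C]

/-- A span `A ⟵ D ⟶ B` in `C` -/
structure SpanDiag (A B : C) where
  /-- the apex -/
  apex : C
  /-- the left leg -/
  left : apex ⟶ A
  /-- the right leg -/
  right : apex ⟶ B

/-- Two spans are identified when there is an isomorphism of the apices compatible with the
legs. -/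
instance SpanDiag.setoid (A B : C) : Setoid (SpanDiag A B) where
  r S T := ∃ e : S.apex ≅ T.apex, e.hom ≫ T.left = S.left ∧ e.hom ≫ T.right = S.right
  iseqv :=
    { refl := fun S => ⟨Iso.refl _, by simp, by simp⟩
      symm := by
        rintro S T ⟨e, h1, h2⟩
        exact ⟨e.symm, by simp [← h1], by simp [← h2]⟩
      trans := by
        rintro S T U ⟨e, h1, h2⟩ ⟨e', h3, h4⟩
        exact ⟨e ≪≫ e', by simp [h3, h1], by simp [h4, h2]⟩ }

/-- Composition of spans by pullback. -/
def SpanDiag.comp [HasPullbacks C] {A B D : C} (S : SpanDiag A B) (T : SpanDiag B D) :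
    SpanDiag A D where
  apex := pullback S.right T.left
  left := pullback.fst S.right T.left ≫ S.left
  right := pullback.snd S.right T.left ≫ T.right

/-- The composite of two spans can be computed with any pullback square. -/
theorem SpanDiag.comp_equiv_of_isPullback [HasPullbacks C] {A B D : C} (S : SpanDiag A B)
    (T : SpanDiag B D) {P : C} {p : P ⟶ S.apex} {r : P ⟶ T.apex}
    (h : IsPullback p r S.right T.left) :
    S.comp T ≈ ⟨P, p ≫ S.left, r ≫ T.right⟩ :=
  ⟨h.isoPullback.symm, by simp [SpanDiag.comp], by simp [SpanDiag.comp]⟩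

theorem SpanDiag.comp_congr [HasPullbacks C] {A B D : C} {S S' : SpanDiag A B}
    {T T' : SpanDiag B D} (hS : S ≈ S') (hT : T ≈ T') : S.comp T ≈ S'.comp T' := by
  obtain ⟨e, h1, h2⟩ := hS
  obtain ⟨e', h3, h4⟩ := hT
  have H : IsPullback (pullback.fst S.right T.left ≫ e.hom) (pullback.snd S.right T.left ≫ e'.hom)
      S'.right T'.left :=
    IsPullback.of_iso (IsPullback.of_hasPullback S.right T.left) (Iso.refl _) e e' (Iso.refl _)
      (by simp) (by simp) (by simp [h2]) (by simp [h3])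
  refine Setoid.trans ?_ (Setoid.symm (SpanDiag.comp_equiv_of_isPullback S' T' H))
  exact ⟨Iso.refl _, by simp [SpanDiag.comp, h1], by simp [SpanDiag.comp, h4]⟩

variable [HasPullbacks C]

instance : Category (Sp C) where
  Hom A B := Quotient (SpanDiag.setoid A.obj B.obj)
  id A := ⟦⟨A.obj, 𝟙 _, 𝟙 _⟩⟧
  comp := Quotient.map₂ SpanDiag.comp fun _ _ h _ _ h' => SpanDiag.comp_congr h h'
  id_comp := by
    rintro A B ⟨S⟩
    refine Quotient.sound (Setoid.trans (SpanDiag.comp_equiv_of_isPullback _ S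
      (IsPullback.of_vert_isIso (fst := S.left) (snd := 𝟙 _) ⟨by simp⟩)) ?_)
    exact ⟨Iso.refl _, by simp, by simp⟩
  comp_id := by
    rintro A B ⟨S⟩
    refine Quotient.sound (Setoid.trans (SpanDiag.comp_equiv_of_isPullback S _
      (IsPullback.of_horiz_isIso (fst := 𝟙 _) (snd := S.right) ⟨by simp⟩)) ?_)
    exact ⟨Iso.refl _, by simp, by simp⟩
  assoc := by
    rintro A B D E ⟨S⟩ ⟨T⟩ ⟨U⟩
    let P1 := IsPullback.of_hasPullback S.right T.left
    let P2 := IsPullback.of_hasPullback T.right U.left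
    let P3 := IsPullback.of_hasPullback (pullback.snd S.right T.left) (pullback.fst T.right U.left)
    refine Quotient.sound (Setoid.trans (SpanDiag.comp_equiv_of_isPullback (S.comp T) U
      (P3.paste_vert P2)) (Setoid.trans ?_ (Setoid.symm
        (SpanDiag.comp_equiv_of_isPullback S (T.comp U) (P3.paste_horiz P1)))))
    exact ⟨Iso.refl _, by simp [SpanDiag.comp], by simp [SpanDiag.comp]⟩

/-- The morphism of `Sp(C)` represented by the span `A ⟵ D ⟶ B`. -/
def Sp.ofSpan {A B D : C} (f : D ⟶ A) (g : D ⟶ B) : (⟨A⟩ : Sp C) ⟶ ⟨B⟩ :=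
  Quotient.mk (SpanDiag.setoid A B) ⟨D, f, g⟩

end Sp

/-! ### The category `E_q` -/

/-- Objects of `E_q`: non-degenerate finite-dimensional quadratic spaces over `𝔽₂`. -/
structure NSpace : Type (u + 1) extends QSpace.{u} where
  nondeg : toQSpace.IsNondegenerate

theorem NSpace.eq_of_B (V : NSpace.{u}) {v v' : V.carrier}
    (h : ∀ w, V.B v w = V.B v' w) : v = v' := by
  rw [← sub_eq_zero]
  refine (V.toQSpace.isNondegenerate_iff).1 V.nondeg _ fun w => ?_
  rw [map_sub, LinearMap.sub_apply, h, sub_self]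

/-- Morphisms of `E_q`: linear maps preserving the quadratic forms. -/
@[ext]
structure NSpace.Hom (V W : NSpace.{u}) : Type u where
  /-- the underlying linear map preserving the quadratic forms -/
  toIsometry : V.form →qᵢ W.form

instance : Category NSpace.{u} where
  Hom V W := NSpace.Hom V W
  id V := ⟨QuadraticMap.Isometry.id V.form⟩
  comp f g := ⟨g.toIsometry.comp f.toIsometry⟩

@[simp]
theorem NSpace.id_apply (V : NSpace.{u}) (x : V.carrier) :
    NSpace.Hom.toIsometry (𝟙 V) x = x := rfl

@[simp]
theorem NSpace.comp_apply {U V W : NSpace.{u}} (f : U ⟶ V) (g : V ⟶ W) (x : U.carrier) :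
    NSpace.Hom.toIsometry (f ≫ g) x = g.toIsometry (f.toIsometry x) := rfl

theorem NSpace.hom_ext {V W : NSpace.{u}} {f g : V ⟶ W}
    (h : ∀ x, f.toIsometry x = g.toIsometry x) : f = g :=
  NSpace.Hom.ext (DFunLike.ext _ _ h)

theorem NSpace.hom_congr {V W : NSpace.{u}} {f g : V ⟶ W} (h : f = g) (x : V.carrier) :
    f.toIsometry x = g.toIsometry x := by rw [h]

theorem NSpace.map_B {V W : NSpace.{u}} (f : V ⟶ W) (x y : V.carrier) :
    W.B (f.toIsometry x) (f.toIsometry y) = V.B x y := by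
  simp only [QuadraticMap.polarBilin_apply_apply, QuadraticMap.polar, ← map_add,
    f.toIsometry.map_app]

theorem NSpace.injective {V W : NSpace.{u}} (f : V ⟶ W) : Function.Injective f.toIsometry := by
  intro x y h
  refine V.eq_of_B fun w => ?_
  rw [← NSpace.map_B f, h, NSpace.map_B f]

/-- The inclusion functor `E_q ⥤ E_q^deg`. -/
def incl : NSpace.{u} ⥤ QSpace.{u} where
  obj V := V.toQSpace
  map f := ⟨f.toIsometry, NSpace.injective f⟩

/-! ### Orthogonal decomposition and the pseudo push-out -/

theorem NSpace.B_nondegenerate (V : NSpace.{u}) : V.B.Nondegenerate := by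
  constructor
  · intro x h
    exact V.eq_of_B fun w => by rw [h w, map_zero, LinearMap.zero_apply]
  · intro x h
    exact V.eq_of_B fun w => by
      rw [V.B_comm, h w, map_zero, LinearMap.zero_apply]

/-- For `f : V ⟶ W` in `E_q`, the linear map `r : W → V` such that `f ∘ r` is the projection of
`W = f(V) ⊥ f(V)^⊥` onto `f(V)`: it is characterised by `B(r w, v) = B(w, f v)`. -/
def retr {V W : NSpace.{u}} (f : V ⟶ W) : W.carrier →ₗ[ZMod 2] V.carrier :=
  (LinearMap.BilinForm.toDual V.B V.B_nondegenerate).symm.toLinearMap ∘ₗ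
    f.toIsometry.toLinearMap.dualMap ∘ₗ W.B

theorem B_retr {V W : NSpace.{u}} (f : V ⟶ W) (w : W.carrier) (v : V.carrier) :
    V.B (retr f w) v = W.B w (f.toIsometry v) :=
  LinearMap.BilinForm.apply_toDual_symm_apply (hB := V.B_nondegenerate) _ _

theorem retr_eq {V W : NSpace.{u}} (f : V ⟶ W) {w : W.carrier} {v : V.carrier}
    (h : ∀ v', W.B w (f.toIsometry v') = V.B v v') : retr f w = v :=
  V.eq_of_B fun v' => by rw [B_retr, h]

@[simp]
theorem retr_apply {V W : NSpace.{u}} (f : V ⟶ W) (v : V.carrier) :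
    retr f (f.toIsometry v) = v :=
  retr_eq f fun v' => NSpace.map_B f v v'

/-- The orthogonal complement `f(V)^⊥` of the image of `f : V ⟶ W`. -/
def perp {V W : NSpace.{u}} (f : V ⟶ W) : Submodule (ZMod 2) W.carrier where
  carrier := {w | ∀ v, W.B w (f.toIsometry v) = 0}
  zero_mem' v := by simp
  add_mem' {a b} ha hb v := by rw [map_add, LinearMap.add_apply, ha v, hb v, add_zero]
  smul_mem' c a ha v := by rw [map_smul, LinearMap.smul_apply, ha v, smul_zero]

theorem retr_perp {V W : NSpace.{u}} (f : V ⟶ W) {w : W.carrier} (h : w ∈ perp f) :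
    retr f w = 0 :=
  retr_eq f fun v' => by rw [h v', map_zero, LinearMap.zero_apply]

/-- The component in `f(V)^⊥` of a vector of `W = f(V) ⊥ f(V)^⊥`. -/
def perpProj {V W : NSpace.{u}} (f : V ⟶ W) : W.carrier →ₗ[ZMod 2] perp f :=
  LinearMap.codRestrict (perp f) (LinearMap.id - f.toIsometry.toLinearMap ∘ₗ retr f) fun w v => by
    change W.B (w - f.toIsometry (retr f w)) _ = 0
    rw [map_sub, LinearMap.sub_apply, NSpace.map_B, B_retr, sub_self]

theorem perpProj_coe {V W : NSpace.{u}} (f : V ⟶ W) (w : W.carrier) :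
    (perpProj f w : W.carrier) = w - f.toIsometry (retr f w) := rfl

theorem decomp {V W : NSpace.{u}} (f : V ⟶ W) (w : W.carrier) :
    f.toIsometry (retr f w) + (perpProj f w : W.carrier) = w := by
  rw [perpProj_coe, add_sub_cancel]

theorem perpProj_apply {V W : NSpace.{u}} (f : V ⟶ W) (v : V.carrier) :
    perpProj f (f.toIsometry v) = 0 := by
  apply Subtype.ext
  rw [perpProj_coe, retr_apply, sub_self]
  rfl

theorem perpProj_of_mem {V W : NSpace.{u}} (f : V ⟶ W) (w : perp f) :
    perpProj f (w : W.carrier) = w := by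
  apply Subtype.ext
  rw [perpProj_coe, retr_perp f w.2, map_zero, sub_zero]

theorem form_decomp {V W : NSpace.{u}} (f : V ⟶ W) (v : V.carrier) (w : perp f) :
    W.form (f.toIsometry v + (w : W.carrier)) = V.form v + W.form (w : W.carrier) := by
  rw [W.form_add, f.toIsometry.map_app, W.B_comm, w.2 v, add_zero]

section Pushout

variable {V W X : NSpace.{u}} (f : V ⟶ W) (g : V ⟶ X)

/-- The orthogonal sum `V ⊥ f(V)^⊥ ⊥ g(V)^⊥` underlying the pseudo push-out. -/
def ppoSpace : QSpace.{u} where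
  carrier := V.carrier × perp f × perp g
  form := V.form.prod ((W.form.comp (perp f).subtype).prod (X.form.comp (perp g).subtype))

theorem ppoSpace_form (z : (ppoSpace f g).carrier) :
    (ppoSpace f g).form z =
      V.form z.1 + (W.form (z.2.1 : W.carrier) + X.form (z.2.2 : X.carrier)) := rfl

theorem ppoSpace_B (z z' : (ppoSpace f g).carrier) :
    (ppoSpace f g).B z z' = V.B z.1 z'.1 +
      (W.B (z.2.1 : W.carrier) (z'.2.1 : W.carrier) +
        X.B (z.2.2 : X.carrier) (z'.2.2 : X.carrier)) := by
  have e1 : (z + z').1 = z.1 + z'.1 := rfl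
  have e2 : ((z + z').2.1 : W.carrier) = z.2.1 + z'.2.1 := rfl
  have e3 : ((z + z').2.2 : X.carrier) = z.2.2 + z'.2.2 := rfl
  simp only [QuadraticMap.polarBilin_apply_apply, QuadraticMap.polar, ppoSpace_form, e1, e2, e3]
  ring

theorem perp_eq_zero {V W : NSpace.{u}} (f : V ⟶ W) {w : W.carrier} (h : w ∈ perp f)
    (h' : ∀ w' ∈ perp f, W.B w w' = 0) : w = 0 := by
  refine W.eq_of_B fun x => ?_
  rw [← decomp f x, map_add, h, h' _ (perpProj f x).2, add_zero, map_zero, LinearMap.zero_apply]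

/-- The pseudo push-out `W ⊥_V X = V ⊥ V' ⊥ V''`, where `W = f(V) ⊥ V'` and `X = g(V) ⊥ V''`. -/
def ppo : NSpace.{u} where
  toQSpace := ppoSpace f g
  nondeg := by
    rw [QSpace.isNondegenerate_iff]
    rintro ⟨v, w, x⟩ h
    have hv : v = 0 := V.eq_of_B fun v' => by
      have := (ppoSpace_B f g (v, w, x) (v', 0, 0)).symm.trans (h (v', 0, 0))
      simpa only [Submodule.coe_zero, map_zero, add_zero, LinearMap.zero_apply] using this
    have hw : w = 0 := Subtype.ext (perp_eq_zero f w.2 fun w' hw' => by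
      have := (ppoSpace_B f g (v, w, x) (0, ⟨w', hw'⟩, 0)).symm.trans (h (0, ⟨w', hw'⟩, 0))
      simpa only [Submodule.coe_zero, map_zero, add_zero, zero_add] using this)
    have hx : x = 0 := Subtype.ext (perp_eq_zero g x.2 fun x' hx' => by
      have := (ppoSpace_B f g (v, w, x) (0, 0, ⟨x', hx'⟩)).symm.trans (h (0, 0, ⟨x', hx'⟩))
      simpa only [Submodule.coe_zero, map_zero, add_zero, zero_add] using this)
    rw [hv, hw, hx]
    rfl

theorem ppo_B (z z' : (ppo f g).carrier) :
    (ppo f g).B z z' = V.B z.1 z'.1 +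
      (W.B (z.2.1 : W.carrier) (z'.2.1 : W.carrier) +
        X.B (z.2.2 : X.carrier) (z'.2.2 : X.carrier)) := ppoSpace_B f g z z'

/-- The map `W ≃ V ⊥ V' → V ⊥ V' ⊥ V''`. -/
def ppoInl : W ⟶ ppo f g where
  toIsometry :=
    { toLinearMap := (retr f).prod ((perpProj f).prod 0)
      map_app' := fun w => by
        change V.form (retr f w) + (W.form (perpProj f w : W.carrier) + X.form (0 : X.carrier)) = _
        rw [QuadraticMap.map_zero, add_zero, ← form_decomp, decomp] }

/-- The map `X ≃ V ⊥ V'' → V ⊥ V' ⊥ V''`. -/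
def ppoInr : X ⟶ ppo f g where
  toIsometry :=
    { toLinearMap := (retr g).prod (LinearMap.prod 0 (perpProj g))
      map_app' := fun x => by
        change V.form (retr g x) + (W.form (0 : W.carrier) + X.form (perpProj g x : X.carrier)) = _
        rw [QuadraticMap.map_zero, zero_add, ← form_decomp, decomp] }

theorem ppoInl_apply (w : W.carrier) :
    (ppoInl f g).toIsometry w = (retr f w, perpProj f w, 0) := rfl

theorem ppoInr_apply (x : X.carrier) :
    (ppoInr f g).toIsometry x = (retr g x, 0, perpProj g x) := rfl

theorem ppo_condition : f ≫ ppoInl f g = g ≫ ppoInr f g :=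
  NSpace.hom_ext fun v => by
    rw [NSpace.comp_apply, NSpace.comp_apply, ppoInl_apply, ppoInr_apply, retr_apply, retr_apply,
      perpProj_apply, perpProj_apply]

theorem ppo_B_inl_inr (w : W.carrier) (x : X.carrier) :
    (ppo f g).B ((ppoInl f g).toIsometry w) ((ppoInr f g).toIsometry x) =
      V.B (retr f w) (retr g x) := by
  rw [ppo_B, ppoInl_apply, ppoInr_apply]
  simp only [Submodule.coe_zero, map_zero, LinearMap.zero_apply, add_zero]

theorem ppo_eq_add (z : (ppo f g).carrier) :
    ∃ w x, z = (ppoInl f g).toIsometry w + (ppoInr f g).toIsometry x := by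
  obtain ⟨v, w, x⟩ := z
  refine ⟨f.toIsometry v + w, x, ?_⟩
  rw [ppoInl_apply, ppoInr_apply, map_add, map_add, retr_apply, perpProj_apply, retr_perp f w.2,
    retr_perp g x.2, perpProj_of_mem, perpProj_of_mem]
  refine Prod.ext ?_ (Prod.ext ?_ ?_)
  · change v = v + 0 + 0
    rw [add_zero, add_zero]
  · change w = 0 + w + 0
    rw [add_zero, zero_add]
  · change x = 0 + x
    rw [zero_add]

variable {f g}

/-- The map out of a pseudo push-out induced by a commutative square `i f = j g` in which
`i(f(V)^⊥)` and `j(g(V)^⊥)` are orthogonal. -/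
def ppoDesc {P : NSpace.{u}} (i : W ⟶ P) (j : X ⟶ P) (_hij : f ≫ i = g ≫ j)
    (h : ∀ w x, P.B (i.toIsometry w) (j.toIsometry x) = V.B (retr f w) (retr g x)) :
    ppo f g ⟶ P where
  toIsometry :=
    { toLinearMap := (i.toIsometry.toLinearMap ∘ₗ f.toIsometry.toLinearMap).coprod
        ((i.toIsometry.toLinearMap ∘ₗ (perp f).subtype).coprod
          (j.toIsometry.toLinearMap ∘ₗ (perp g).subtype))
      map_app' := by
        rintro ⟨v, w, x⟩
        change P.form (i.toIsometry (f.toIsometry v) +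
          (i.toIsometry (w : W.carrier) + j.toIsometry (x : X.carrier))) =
          V.form v + (W.form (w : W.carrier) + X.form (x : X.carrier))
        rw [← add_assoc, ← map_add, P.form_add, h, retr_perp g x.2, map_zero, add_zero,
          i.toIsometry.map_app, j.toIsometry.map_app, form_decomp, add_assoc] }

theorem ppoDesc_apply {P : NSpace.{u}} (i : W ⟶ P) (j : X ⟶ P) (hij : f ≫ i = g ≫ j) (h)
    (z : (ppo f g).carrier) : (ppoDesc i j hij h).toIsometry z =
      i.toIsometry (f.toIsometry z.1) +
        (i.toIsometry (z.2.1 : W.carrier) + j.toIsometry (z.2.2 : X.carrier)) := rfl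

theorem ppoInl_desc {P : NSpace.{u}} (i : W ⟶ P) (j : X ⟶ P) (hij : f ≫ i = g ≫ j) (h) :
    ppoInl f g ≫ ppoDesc i j hij h = i :=
  NSpace.hom_ext fun w => by
    rw [NSpace.comp_apply, ppoDesc_apply, ppoInl_apply]
    change i.toIsometry (f.toIsometry (retr f w)) + (i.toIsometry (perpProj f w : W.carrier) +
      j.toIsometry (0 : X.carrier)) = _
    rw [map_zero, add_zero, ← map_add, decomp]

theorem ppoInr_desc {P : NSpace.{u}} (i : W ⟶ P) (j : X ⟶ P) (hij : f ≫ i = g ≫ j) (h) :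
    ppoInr f g ≫ ppoDesc i j hij h = j :=
  NSpace.hom_ext fun x => by
    rw [NSpace.comp_apply, ppoDesc_apply, ppoInr_apply]
    change i.toIsometry (f.toIsometry (retr g x)) + (i.toIsometry (0 : W.carrier) +
      j.toIsometry (perpProj g x : X.carrier)) = _
    rw [map_zero, zero_add, ← NSpace.comp_apply, hij, NSpace.comp_apply, ← map_add, decomp]

end Pushout

/-- The pseudo push-out square is a pullback square in `E_q^deg`. -/
theorem ppo_isPullback {V W X : NSpace.{u}} (f : V ⟶ W) (g : V ⟶ X) :
    IsPullback (incl.map f) (incl.map g) (incl.map (ppoInl f g)) (incl.map (ppoInr f g)) := by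
  refine QSpace.isPullback_of_elements
    (by rw [← Functor.map_comp, ← Functor.map_comp, ppo_condition]) fun w x h => ?_
  have h' : ((retr f w, perpProj f w, 0) : V.carrier × perp f × perp g) =
    (retr g x, 0, perpProj g x) := h
  simp only [Prod.mk.injEq] at h'
  obtain ⟨h1, h2, h3⟩ := h'
  refine ⟨retr f w, ?_, ?_⟩
  · have := decomp f w
    rw [h2, Submodule.coe_zero, add_zero] at this
    exact this
  · have := decomp g x
    rw [← h3, Submodule.coe_zero, add_zero, ← h1] at this
    exact this

/-! ### The category `T_q` -/

/-- The category `T_q`: its objects are those of `E_q`. -/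
structure Tq : Type (u + 1) where
  /-- the underlying non-degenerate quadratic space -/
  obj : NSpace.{u}

/-- A diagram `V ⟶ X ⟵ W` in `E_q`. -/
structure CospanDiag (V W : NSpace.{u}) : Type (u + 1) where
  /-- the apex -/
  apex : NSpace.{u}
  /-- the left leg -/
  left : V ⟶ apex
  /-- the right leg -/
  right : W ⟶ apex

/-- `V ⟶ X₁ ⟵ W` is related to `V ⟶ X₂ ⟵ W` if there is a morphism `α : X₁ ⟶ X₂` of `E_q`
compatible with the legs. In particular isomorphic diagrams are related. -/
def CospanDiag.Rel {V W : NSpace.{u}} (S T : CospanDiag V W) : Prop :=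
  ∃ α : S.apex ⟶ T.apex, S.left ≫ α = T.left ∧ S.right ≫ α = T.right

/-- Morphisms of `T_q`: diagrams `V ⟶ X ⟵ W` up to the equivalence relation generated by
`CospanDiag.Rel`. As isomorphic diagrams are related, this is also the quotient of the set of
isomorphism classes of diagrams by the generated equivalence relation. -/
def Tq.Hom (V W : NSpace.{u}) : Type (u + 1) :=
  Quot (CospanDiag.Rel (V := V) (W := W))

/-- Composition of diagrams through the pseudo push-out. -/
def CospanDiag.comp {V W Y : NSpace.{u}} (S : CospanDiag V W) (T : CospanDiag W Y) :
    CospanDiag V Y where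
  apex := ppo S.right T.left
  left := S.left ≫ ppoInl S.right T.left
  right := T.right ≫ ppoInr S.right T.left

theorem CospanDiag.comp_rel {V W Y : NSpace.{u}} (S : CospanDiag V W) (T : CospanDiag W Y)
    {P : NSpace.{u}} (i : S.apex ⟶ P) (j : T.apex ⟶ P) (hij : S.right ≫ i = T.left ≫ j)
    (h : ∀ x y, P.B (i.toIsometry x) (j.toIsometry y) =
      W.B (retr S.right x) (retr T.left y)) :
    (S.comp T).Rel ⟨P, S.left ≫ i, T.right ≫ j⟩ :=
  ⟨ppoDesc i j hij h,
    by change (S.left ≫ ppoInl _ _) ≫ _ = _; rw [Category.assoc, ppoInl_desc],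
    by change (T.right ≫ ppoInr _ _) ≫ _ = _; rw [Category.assoc, ppoInr_desc]⟩

theorem retr_comp_apply {V W X : NSpace.{u}} (f : V ⟶ W) (g : W ⟶ X) (w : W.carrier) :
    retr (f ≫ g) (g.toIsometry w) = retr f w :=
  retr_eq _ fun v' => by rw [NSpace.comp_apply, NSpace.map_B, B_retr]

theorem CospanDiag.comp_rel_left {V W Y : NSpace.{u}} {S S' : CospanDiag V W}
    (T : CospanDiag W Y) (h : S.Rel S') : (S.comp T).Rel (S'.comp T) := by
  obtain ⟨α, h1, h2⟩ := h
  have := CospanDiag.comp_rel S T (α ≫ ppoInl S'.right T.left) (ppoInr S'.right T.left)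
    (by rw [← Category.assoc, h2, ppo_condition]) (fun x y => by
      rw [NSpace.comp_apply, ppo_B_inl_inr, ← h2, retr_comp_apply])
  rwa [← Category.assoc, h1] at this

theorem CospanDiag.comp_rel_right {V W Y : NSpace.{u}} (S : CospanDiag V W)
    {T T' : CospanDiag W Y} (h : T.Rel T') : (S.comp T).Rel (S.comp T') := by
  obtain ⟨α, h1, h2⟩ := h
  have := CospanDiag.comp_rel S T (ppoInl S.right T'.left) (α ≫ ppoInr S.right T'.left)
    (by rw [← Category.assoc, h1, ppo_condition]) (fun x y => by
      rw [NSpace.comp_apply, ppo_B_inl_inr, ← h1, retr_comp_apply])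
  rwa [← Category.assoc, h2] at this

theorem retr_id {V : NSpace.{u}} (v : V.carrier) : retr (𝟙 V) v = v :=
  retr_eq _ fun _ => rfl

theorem ppo_assoc {W Y X₁ X₂ X₃ : NSpace.{u}} (b : W ⟶ X₁) (c : W ⟶ X₂) (d : Y ⟶ X₂)
    (e : Y ⟶ X₃) :
    ∃ φ : ppo (d ≫ ppoInr b c) e ⟶ ppo b (c ≫ ppoInl d e),
      ppoInl b c ≫ ppoInl (d ≫ ppoInr b c) e ≫ φ = ppoInl b (c ≫ ppoInl d e) ∧
      ppoInr (d ≫ ppoInr b c) e ≫ φ = ppoInr d e ≫ ppoInr b (c ≫ ppoInl d e) := by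
  have o1 : ∀ x y, (ppo b (c ≫ ppoInl d e)).B ((ppoInl b (c ≫ ppoInl d e)).toIsometry x)
      ((ppoInl d e ≫ ppoInr b (c ≫ ppoInl d e)).toIsometry y) =
      W.B (retr b x) (retr c y) := fun x y => by
    rw [NSpace.comp_apply, ppo_B_inl_inr, retr_comp_apply]
  have c1 : b ≫ ppoInl b (c ≫ ppoInl d e) = c ≫ ppoInl d e ≫ ppoInr b (c ≫ ppoInl d e) := by
    rw [ppo_condition, Category.assoc]
  let ψ : ppo b c ⟶ ppo b (c ≫ ppoInl d e) := ppoDesc _ _ c1 o1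
  have ψl : ppoInl b c ≫ ψ = ppoInl b (c ≫ ppoInl d e) := ppoInl_desc _ _ _ _
  have ψr : ppoInr b c ≫ ψ = ppoInl d e ≫ ppoInr b (c ≫ ppoInl d e) := ppoInr_desc _ _ _ _
  have c2 : (d ≫ ppoInr b c) ≫ ψ = e ≫ ppoInr d e ≫ ppoInr b (c ≫ ppoInl d e) := by
    rw [Category.assoc, ψr, ← Category.assoc, ← Category.assoc, ppo_condition]
  have o2 : ∀ z y, (ppo b (c ≫ ppoInl d e)).B (ψ.toIsometry z)
      ((ppoInr d e ≫ ppoInr b (c ≫ ppoInl d e)).toIsometry y) =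
      Y.B (retr (d ≫ ppoInr b c) z) (retr e y) := by
    intro z y
    obtain ⟨s, t, rfl⟩ := ppo_eq_add b c z
    have e1 : ψ.toIsometry ((ppoInl b c).toIsometry s) =
      (ppoInl b (c ≫ ppoInl d e)).toIsometry s := NSpace.hom_congr ψl s
    have e2 : ψ.toIsometry ((ppoInr b c).toIsometry t) =
      (ppoInr b (c ≫ ppoInl d e)).toIsometry ((ppoInl d e).toIsometry t) := NSpace.hom_congr ψr t
    have e3 : retr (d ≫ ppoInr b c) ((ppoInl b c).toIsometry s + (ppoInr b c).toIsometry t) =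
        retr d (c.toIsometry (retr b s)) + retr d t :=
      retr_eq _ fun y' => by
        rw [NSpace.comp_apply, map_add, LinearMap.add_apply, ppo_B_inl_inr, W.B_comm, B_retr c,
          X₂.B_comm, NSpace.map_B, map_add, LinearMap.add_apply, B_retr d, B_retr d]
    have e4 : (ppo b (c ≫ ppoInl d e)).B ((ppoInl b (c ≫ ppoInl d e)).toIsometry s)
        ((ppoInr b (c ≫ ppoInl d e)).toIsometry ((ppoInr d e).toIsometry y)) =
        Y.B (retr d (c.toIsometry (retr b s))) (retr e y) := by
      rw [ppo_B_inl_inr, W.B_comm, B_retr, QSpace.B_comm, NSpace.comp_apply, ppo_B_inl_inr]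
    rw [map_add, e1, e2, e3, NSpace.comp_apply, map_add, LinearMap.add_apply, e4, NSpace.map_B,
      ppo_B_inl_inr, map_add, LinearMap.add_apply]
  refine ⟨ppoDesc _ _ c2 o2, ?_, ?_⟩
  · rw [ppoInl_desc, ψl]
  · rw [ppoInr_desc]

theorem CospanDiag.assoc_rel {V W Y Z : NSpace.{u}} (S : CospanDiag V W) (T : CospanDiag W Y)
    (U : CospanDiag Y Z) : ((S.comp T).comp U).Rel (S.comp (T.comp U)) := by
  obtain ⟨X₁, a, b⟩ := S
  obtain ⟨X₂, c, d⟩ := T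
  obtain ⟨X₃, e, k⟩ := U
  obtain ⟨φ, h1, h2⟩ := ppo_assoc b c d e
  refine ⟨φ, ?_, ?_⟩
  · change ((a ≫ ppoInl b c) ≫ ppoInl (d ≫ ppoInr b c) e) ≫ φ = a ≫ ppoInl b (c ≫ ppoInl d e)
    rw [Category.assoc, Category.assoc, h1]
  · change (k ≫ ppoInr (d ≫ ppoInr b c) e) ≫ φ =
      (k ≫ ppoInr d e) ≫ ppoInr b (c ≫ ppoInl d e)
    rw [Category.assoc, h2, Category.assoc]

instance : Category Tq.{u} where
  Hom V W := Tq.Hom V.obj W.obj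
  id V := Quot.mk _ ⟨V.obj, 𝟙 _, 𝟙 _⟩
  comp := Quot.map₂ CospanDiag.comp (fun S _ _ h => CospanDiag.comp_rel_right S h)
    fun _ _ T h => CospanDiag.comp_rel_left T h
  id_comp := by
    rintro V W ⟨S⟩
    have := CospanDiag.comp_rel ⟨V.obj, 𝟙 _, 𝟙 _⟩ S S.left (𝟙 _) (by simp) (fun x y => by
      rw [retr_id, NSpace.id_apply, QSpace.B_comm, ← B_retr, QSpace.B_comm])
    rw [Category.id_comp, Category.comp_id] at this
    exact Quot.sound this
  comp_id := by
    rintro V W ⟨S⟩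
    have := CospanDiag.comp_rel S ⟨W.obj, 𝟙 _, 𝟙 _⟩ (𝟙 _) S.right (by simp) (fun x y => by
      rw [retr_id, NSpace.id_apply, ← B_retr])
    rw [Category.id_comp, Category.comp_id] at this
    exact Quot.sound this
  assoc := by
    rintro V W Y Z ⟨S⟩ ⟨T⟩ ⟨U⟩
    exact Quot.sound (CospanDiag.assoc_rel S T U)

/-- The morphism of `T_q` represented by the diagram `V ⟶ X ⟵ W` of `E_q`. -/
def Tq.ofCospan {V W X : NSpace.{u}} (f : V ⟶ X) (g : W ⟶ X) : (⟨V⟩ : Tq.{u}) ⟶ ⟨W⟩ :=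
  Quot.mk (CospanDiag.Rel (V := V) (W := W)) ⟨X, f, g⟩

/-! ### The category `S_q` and the functor `σ` -/

/-- The category `S_q`: the full subcategory of `Sp(E_q^deg)` on the non-degenerate spaces. -/
abbrev Sq : Type (u + 1) :=
  ObjectProperty.FullSubcategory fun V : Sp QSpace.{u} => V.obj.IsNondegenerate

/-- The object of `S_q` given by a non-degenerate quadratic space. -/
def Sq.of (V : NSpace.{u}) : Sq.{u} := ⟨⟨incl.obj V⟩, V.nondeg⟩

/-- The morphism of `S_q` represented by a span `V ⟵ D ⟶ W` in `E_q^deg` with `V` and `W`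
non-degenerate. -/
def Sq.ofSpan {V W : NSpace.{u}} {D : QSpace.{u}} (f : D ⟶ incl.obj V) (g : D ⟶ incl.obj W) :
    Sq.of V ⟶ Sq.of W :=
  ObjectProperty.homMk (Sp.ofSpan f g)

/-- The span `V ⟵ V ×_X W ⟶ W` given by the pullback in `E_q^deg` of a diagram `V ⟶ X ⟵ W` of
`E_q`. -/
def CospanDiag.toSpan {V W : NSpace.{u}} (S : CospanDiag V W) :
    SpanDiag (incl.obj V) (incl.obj W) where
  apex := pullback (incl.map S.left) (incl.map S.right)
  left := pullback.fst _ _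
  right := pullback.snd _ _

theorem CospanDiag.toSpan_equiv {V W : NSpace.{u}} (S : CospanDiag V W) {P : QSpace.{u}}
    {p : P ⟶ incl.obj V} {r : P ⟶ incl.obj W}
    (h : IsPullback p r (incl.map S.left) (incl.map S.right)) : S.toSpan ≈ ⟨P, p, r⟩ :=
  ⟨h.isoPullback.symm, by simp [CospanDiag.toSpan], by simp [CospanDiag.toSpan]⟩

theorem CospanDiag.toSpan_rel {V W : NSpace.{u}} {S T : CospanDiag V W} (h : S.Rel T) :
    S.toSpan ≈ T.toSpan := by
  obtain ⟨α, h1, h2⟩ := h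
  refine Setoid.symm (CospanDiag.toSpan_equiv T (p := pullback.fst _ _) (r := pullback.snd _ _) ?_)
  rw [← h1, ← h2, Functor.map_comp, Functor.map_comp]
  exact IsPullback.of_isLimit
    (pullbackIsPullbackOfCompMono (incl.map S.left) (incl.map S.right) (incl.map α))

/-- `σ` on morphisms. -/
def sigmaMap {V W : NSpace.{u}} (T : Tq.Hom V W) : Sq.of V ⟶ Sq.of W :=
  ObjectProperty.homMk (Quot.lift
    (fun S : CospanDiag V W => (Quotient.mk (SpanDiag.setoid _ _) S.toSpan :
      (⟨incl.obj V⟩ : Sp QSpace.{u}) ⟶ ⟨incl.obj W⟩))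
    (fun _ _ h => Quotient.sound (CospanDiag.toSpan_rel h)) T)

/-- The functor `σ : T_q ⥤ S_q`, which is the identity on objects and sends the class of
`V ⟶ X ⟵ W` to the class of `V ⟵ V ×_X W ⟶ W`. -/
def sigma : Tq.{u} ⥤ Sq.{u} where
  obj V := Sq.of V.obj
  map T := sigmaMap T
  map_id V := by
    refine ObjectProperty.hom_ext _ (Quotient.sound (CospanDiag.toSpan_equiv _
      (p := 𝟙 _) (r := 𝟙 _) (IsPullback.of_id_fst (f := 𝟙 _))))
  map_comp := by
    rintro V W Y ⟨S⟩ ⟨T⟩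
    let P1 := IsPullback.of_hasPullback (incl.map S.left) (incl.map S.right)
    let P2 := IsPullback.of_hasPullback (incl.map T.left) (incl.map T.right)
    let P3 := IsPullback.of_hasPullback (pullback.snd (incl.map S.left) (incl.map S.right))
      (pullback.fst (incl.map T.left) (incl.map T.right))
    have Q := ppo_isPullback S.right T.left
    have H := (P3.paste_horiz P1).paste_vert (P2.paste_horiz Q)
    exact ObjectProperty.hom_ext _ (Quotient.sound (CospanDiag.toSpan_equiv (S.comp T) H))

end QuadF2

end

noncomputable section

namespace QuadF2

/-! It suffices to complete the span to a square in `E_q^deg` that is cartesian and whose fourth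
corner is non-degenerate; by uniqueness of pullbacks `σ` then sends the resulting cospan to the
given class. The two requirements are met separately, and D never has to be split into its radical
and a complement.

For the cartesian square (`exists_isPullback`), choose linear retractions s of f and p of g. Then W
= g(D) ⊕ ker p, and the linear amalgam of V and W along D is V ⊕ ker p. A quadratic form on it
extending those of V and W is determined by the pairing of v with k in ker p. The form of W forces
this pairing to be B(g d, k) when v = f d and leaves it free otherwise, so B(g(s v), k) is a valid
choice. The same formula makes sense on all of V × W; this larger space serves as well, since only
the images of V and W matter for the pullback.

For non-degeneracy (`exists_hom_nondegenerate`), any Y sits as 0 × Y in Y* × Y with form φ(y) +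
q(y), where the evaluation pairing kills the radical. Enlarging the corner along a monomorphism does
not change the pullback. -/

namespace QSpace

/-! ### Embedding into a non-degenerate space -/

/-- The quadratic form `(φ, y) ↦ φ y + q y` on `Y* × Y`. -/
def dualExtension (Y : QSpace.{u}) : QSpace.{u} where
  carrier := Module.Dual (ZMod 2) Y.carrier × Y.carrier
  form := QuadraticForm.dualProd (ZMod 2) Y.carrier +
    Y.form.comp (LinearMap.snd (ZMod 2) (Module.Dual (ZMod 2) Y.carrier) Y.carrier)

theorem dualExtension_B (Y : QSpace.{u}) (φ ψ : Module.Dual (ZMod 2) Y.carrier)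
    (y z : Y.carrier) : Y.dualExtension.B (φ, y) (ψ, z) = φ z + ψ y + Y.B y z := by
  change (φ + ψ) (y + z) + Y.form (y + z) - (φ y + Y.form y) - (ψ z + Y.form z) =
    φ z + ψ y + (Y.form (y + z) - Y.form y - Y.form z)
  rw [LinearMap.add_apply, map_add, map_add]
  ring

/-- The duality between Y* and Y dominates whatever the form of Y does: functionals detect the
Y-component of a radical vector, and once it vanishes, vectors of Y detect the functional. -/
theorem dualExtension_isNondegenerate (Y : QSpace.{u}) : Y.dualExtension.IsNondegenerate := by
  rw [isNondegenerate_iff]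
  rintro ⟨φ, y⟩ h
  -- Against (ψ, 0) the term in the bilinear form of Y disappears and only ψ(y) remains.
  have hy : y = 0 := (Module.forall_dual_apply_eq_zero_iff (ZMod 2) y).1 fun ψ => by
    simpa only [map_zero, zero_add, add_zero] using
      (dualExtension_B Y φ ψ y 0).symm.trans (h (ψ, 0))
  have hφ : φ = 0 := LinearMap.ext fun z => by
    simpa only [hy, map_zero, LinearMap.zero_apply, add_zero] using
      (dualExtension_B Y φ 0 y z).symm.trans (h (0, z))
  rw [hy, hφ]
  rfl

/-- Every quadratic space embeds in a non-degenerate one. -/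
theorem exists_hom_nondegenerate (Y : QSpace.{u}) :
    ∃ X : NSpace.{u}, Nonempty (Y ⟶ incl.obj X) :=
  ⟨⟨Y.dualExtension, Y.dualExtension_isNondegenerate⟩,
    ⟨{ toIsometry :=
        { toLinearMap := LinearMap.inr (ZMod 2) (Module.Dual (ZMod 2) Y.carrier) Y.carrier
          map_app' := fun y => by
            -- On 0 × Y the evaluation term is zero, so the form restricts to that of Y.
            change (0 : Module.Dual (ZMod 2) Y.carrier) y + Y.form y = Y.form y
            rw [LinearMap.zero_apply, zero_add] }
       injective := LinearMap.inr_injective }⟩⟩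

/-! ### Amalgamation of a span into a cartesian square -/

/-- The direct sum of `V` and `W`, with the form twisted by the pairing `B(t v, w)`
for a linear map `t : V → W`. -/
def twistedSum (V W : QSpace.{u}) (t : V.carrier →ₗ[ZMod 2] W.carrier) : QSpace.{u} where
  carrier := V.carrier × W.carrier
  form := V.form.prod W.form + LinearMap.BilinMap.toQuadraticMap
    (W.B.compl₁₂ (t ∘ₗ LinearMap.fst (ZMod 2) V.carrier W.carrier)
      (LinearMap.snd (ZMod 2) V.carrier W.carrier))

/-- Every span of quadratic spaces is a pullback: it can be completed to a cartesian square. -/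
theorem exists_isPullback {D V W : QSpace.{u}} (f : D ⟶ V) (g : D ⟶ W) :
    ∃ (Y : QSpace.{u}) (i : V ⟶ Y) (j : W ⟶ Y), IsPullback f g i j := by
  -- Over a field the injections f and g split. The retractions s and p are merely linear: they need
  -- not respect the forms, and only their values on the images of D are used.
  obtain ⟨s, hs⟩ := LinearMap.exists_leftInverse_of_injective f.toIsometry.toLinearMap
    (LinearMap.ker_eq_bot.2 f.injective)
  obtain ⟨p, hp⟩ := LinearMap.exists_leftInverse_of_injective g.toIsometry.toLinearMap
    (LinearMap.ker_eq_bot.2 g.injective)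
  replace hs : ∀ d, s (f.toIsometry d) = d := LinearMap.congr_fun hs
  replace hp : ∀ d, p (g.toIsometry d) = d := LinearMap.congr_fun hp
  -- The twist g ∘ s sends f d to g d, so vectors coming from D pair with W as they do inside W.
  let i : V ⟶ twistedSum V W (g.toIsometry.toLinearMap ∘ₗ s) :=
    { toIsometry :=
        { toLinearMap := LinearMap.inl (ZMod 2) V.carrier W.carrier
          map_app' := fun v => by
            change V.form v + W.form 0 + W.B _ 0 = V.form v
            rw [QuadraticMap.map_zero, map_zero, add_zero, add_zero] }
      injective := LinearMap.inl_injective }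
  let j : W ⟶ twistedSum V W (g.toIsometry.toLinearMap ∘ₗ s) :=
    { toIsometry :=
        -- Write w = g(p w) + (w - g(p w)). The part in g(D) is moved into V through D; the
        -- remainder, which lies in ker p, stays in the second factor.
        { toLinearMap := (f.toIsometry.toLinearMap ∘ₗ p).prod
            (LinearMap.id - g.toIsometry.toLinearMap ∘ₗ p)
          map_app' := fun w => by
            change V.form (f.toIsometry (p w)) + W.form (w - g.toIsometry (p w)) +
              W.B (g.toIsometry (s (f.toIsometry (p w)))) (w - g.toIsometry (p w)) = W.form w
            -- Since s(f(p w)) = p w and q(f(p w)) = q(p w) = q(g(p w)), the left side is the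
            -- expansion of q(g(p w) + (w - g(p w))), with the twist supplying exactly the cross
            -- term.
            rw [hs, f.toIsometry.map_app, ← g.toIsometry.map_app, ← form_add,
              add_sub_cancel] }
      injective := fun w w' h => by
        have h1 : f.toIsometry (p w) = f.toIsometry (p w') := congrArg Prod.fst h
        have h2 : w - g.toIsometry (p w) = w' - g.toIsometry (p w') := congrArg Prod.snd h
        rwa [f.injective h1, sub_left_inj] at h2 }
  -- An equality i v = j w says (v, 0) = (f(p w), w - g(p w)), that is v = f(p w) and w = g(p w);
  -- hence p w is the required point of D.
  refine ⟨_, i, j, isPullback_of_elements (hom_ext fun d => ?_) fun v w h => ⟨p w, ?_, ?_⟩⟩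
  · change (f.toIsometry d, (0 : W.carrier)) =
      (f.toIsometry (p (g.toIsometry d)), g.toIsometry d - g.toIsometry (p (g.toIsometry d)))
    rw [hp, sub_self]
  · exact (congrArg Prod.fst h).symm
  · exact (sub_eq_zero.1 (congrArg Prod.snd h).symm).symm

end QSpace

/-! ### Fullness of `σ` -/

/-- A morphism of `E_q^deg` between non-degenerate spaces is a morphism of `E_q`. -/
def NSpace.ofHom {V X : NSpace.{u}} (f : incl.obj V ⟶ incl.obj X) : V ⟶ X :=
  ⟨f.toIsometry⟩

/-- Every span in `E_q^deg` between non-degenerate spaces is the pullback of a diagram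
in `E_q`. -/
theorem exists_isPullback_incl {V W : NSpace.{u}} {D : QSpace.{u}} (f : D ⟶ incl.obj V)
    (g : D ⟶ incl.obj W) :
    ∃ (X : NSpace.{u}) (a : V ⟶ X) (b : W ⟶ X), IsPullback f g (incl.map a) (incl.map b) := by
  obtain ⟨Y, i, j, h⟩ := QSpace.exists_isPullback f g
  obtain ⟨X, ⟨k⟩⟩ := Y.exists_hom_nondegenerate
  -- Composing both legs with the monomorphism k : Y ⟶ X leaves the pullback D unchanged. The
  -- composites run between non-degenerate spaces, so they belong to `E_q`.
  exact ⟨X, NSpace.ofHom (i ≫ k), NSpace.ofHom (j ≫ k), IsPullback.of_isLimit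
    (PullbackCone.isLimitOfCompMono i j k (PullbackCone.mk f g h.w) h.isLimit)⟩

/-- The chosen pullback defining `σ` and the apex D are both pullbacks of the same cospan, so the
two spans are isomorphic compatibly with their legs and have the same class. -/
theorem exists_sigma_map_ofCospan {V W : NSpace.{u}} {D : QSpace.{u}} (f : D ⟶ incl.obj V)
    (g : D ⟶ incl.obj W) :
    ∃ (X : NSpace.{u}) (a : V ⟶ X) (b : W ⟶ X),
      sigma.map (Tq.ofCospan a b) = Sq.ofSpan f g := by
  obtain ⟨X, a, b, h⟩ := exists_isPullback_incl f g
  exact ⟨X, a, b, ObjectProperty.hom_ext _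
    (Quotient.sound (CospanDiag.toSpan_equiv ⟨X, a, b⟩ h))⟩

theorem sigma_full : sigma.{u}.Full where
  map_surjective := by
    -- A morphism of `S_q` is a class of spans, so it is enough to treat a representative.
    rintro ⟨V⟩ ⟨W⟩ ⟨⟨D, f, g⟩⟩
    obtain ⟨X, a, b, h⟩ := exists_sigma_map_ofCospan f g
    exact ⟨Tq.ofCospan a b, h⟩

end QuadF2

end

/-- The functor `σ : T_q ⥤ S_q` is full; in particular the class in `S_q` of any span
`V ⟵ D ⟶ W` in `E_q^deg`, with `V`, `W` non-degenerate and `D` possibly degenerate, is the image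
under `σ` of the class in `T_q` of some diagram `V ⟶ X ⟵ W` in `E_q`. -/
theorem proposition4p20 :
    QuadF2.sigma.{u}.Full ∧
      ∀ (V W : QuadF2.NSpace.{u}) (D : QuadF2.QSpace.{u}) (f : D ⟶ QuadF2.incl.obj V)
        (g : D ⟶ QuadF2.incl.obj W),
        ∃ (X : QuadF2.NSpace.{u}) (a : V ⟶ X) (b : W ⟶ X),
          QuadF2.sigma.map (QuadF2.Tq.ofCospan a b) = QuadF2.Sq.ofSpan f g :=
  ⟨QuadF2.sigma_full, fun _ _ _ f g => QuadF2.exists_sigma_map_ofCospan f g⟩
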